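/- Let $K$ be a field and let $G$ be a finite group with irreducible complex characters $\operatorname{Irr}(G)=\{\chi_1,\dots,\chi_r\}$, where $\chi_1=1_G$ is the trivial character, and degrees $d_i=\chi_i(1)$. Let $\operatorname{Ch}(G)=\{\sum_i a_i\chi_i : a_i\in\mathbb{N}\}$, where $\mathbb N=\{0,1,2,\dots\}$, and let $M(G)\subseteq\operatorname{Ch}(G)$ be the submonoid generated by the monomial characters, i.e. the characters $\lambda^G$ induced from linear characters $\lambda$ of subgroups $H\leqslant G$. Let $$\widehat{M(G)}=\{\chi\in\operatorname{Ch}(G) : n\chi\in M(G)\text{ for some integer } n\ge 1\}$$ be the integral closure of $M(G)$ in $\operatorname{Ch}(G)$. For a submonoid $N\subseteq \operatorname{Ch}(G)$ let $K[N]\subseteq K[x_1,\dots,x_r]$ be the $K$-subalgebra generated by the monomials $x_1^{a_1}\cdots x_r^{a_r}$ with $\sum_i a_i\chi_i\in N$, and put $R_G=K[M(G)]$ and $\widehat{R_G}=K[\widehat{M(G)}]$ (the normalization of $R_G$). Let $u_G=x_1^{d_1}\cdots x_r^{d_r}$ be the monomial of the regular character. Then $$K\bigl[x_1,\ u_G/x_1,\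 u_G/x_2,\ \dots,\ u_G/x_r\bigr]\subseteq\widehat{R_G},$$ that is, $\widehat{R_G}$ contains $x_1$ and, for each $j\in\{1,\dots,r\}$, the monomial $u_G/x_j=x_1^{d_1}\cdots x_j^{d_j-1}\cdots x_r^{d_r}$. -/

import Mathlib

open scoped Classical in
/-- The function on `G` induced from a linear character `lam` of a subgroup `H`:
`g ↦ |H|⁻¹ ∑ x, lam°(x⁻¹ g x)`, where `lam°` is `lam` extended by zero outside `H`. -/
noncomputable def inducedLinear {G : Type*} [Group G] [Fintype G]
    (H : Subgroup G) (lam : H →* ℂˣ) : G → ℂ := fun g =>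
  (Nat.card H : ℂ)⁻¹ *
    ∑ x : G, if h : x⁻¹ * g * x ∈ H then ((lam ⟨x⁻¹ * g * x, h⟩ : ℂˣ) : ℂ) else 0

/-- The set `Irr(G)` of irreducible complex characters of `G`, as functions on `G`. -/
def irrChars (G : Type*) [Group G] : Set (G → ℂ) :=
  {χ | ∃ (n : ℕ) (ρ : Representation ℂ G (Fin n → ℂ)), ρ.IsIrreducible ∧ ρ.character = χ}

/-- `Irr(G)` as a type. -/
abbrev Irr (G : Type*) [Group G] : Type _ := irrChars G

/-- The degree `d_χ = χ(1)` of an irreducible character (see `irrDegree_spec`). -/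
noncomputable def irrDegree {G : Type*} [Group G] (χ : Irr G) : ℕ := χ.2.choose

theorem irrDegree_spec {G : Type*} [Group G] (χ : Irr G) :
    (χ : G → ℂ) 1 = (irrDegree χ : ℂ) := by
  obtain ⟨ρ, _, h⟩ := χ.2.choose_spec
  have h1 := congrFun h 1
  rw [Representation.char_one, Module.finrank_fin_fun] at h1
  exact h1.symm

theorem irrDegree_pos {G : Type*} [Group G] (χ : Irr G) : 0 < irrDegree χ := by
  obtain ⟨ρ, hρ, _⟩ := χ.2.choose_spec
  rcases Nat.eq_zero_or_pos (irrDegree χ) with h | h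
  · exfalso
    have : IsEmpty (Fin χ.2.choose) := by
      have h' : χ.2.choose = 0 := h
      rw [h']; infer_instance
    obtain ⟨a, b, hab⟩ := hρ.toNontrivial
    apply hab
    ext v
    have hv : v = 0 := Subsingleton.elim _ _
    subst hv
    exact ⟨fun _ => b.toSubmodule.zero_mem, fun _ => a.toSubmodule.zero_mem⟩
  · exact h

/-- Distinct irreducible characters are linearly independent, so `Irr(G)` is finite. -/
instance irr_finite (G : Type*) [Group G] [Finite G] : Finite (Irr G) := by
  classical
  have := Fintype.ofFinite G
  have hc : (Nat.card G : ℂ) ≠ 0 := by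
    exact_mod_cast Nat.card_pos.ne'
  have := invertibleOfNonzero hc
  have key : ∀ χ ψ : Irr G, (Nat.card G : ℂ)⁻¹ * ∑ g : G, χ.1 g * ψ.1 g⁻¹
      = if χ = ψ then 1 else 0 := by
    rintro ⟨χ, n, ρ, hρ, rfl⟩ ⟨ψ, m, σ, hσ, rfl⟩
    by_cases h : ρ.character = σ.character
    · simp only [h, if_true]
      rw [Representation.char_orthonormal σ σ, if_pos ⟨Representation.Equiv.refl σ⟩]
    · rw [Representation.char_orthonormal ρ σ, if_neg, if_neg]
      · exact fun h' => h (congrArg Subtype.val h')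
      · rintro ⟨e⟩
        exact h (Representation.char_iso e).symm
  have li : LinearIndependent ℂ (fun χ : Irr G => (χ : G → ℂ)) := by
    rw [linearIndependent_iff']
    intro s c hs ψ hψ
    have h2 : ∑ χ ∈ s, c χ * ((Nat.card G : ℂ)⁻¹ * ∑ g : G, χ.1 g * ψ.1 g⁻¹) = 0 := by
      have h3 : ∀ g, ∑ χ ∈ s, c χ * χ.1 g = 0 := fun g => by
        simpa using congrFun hs g
      calc ∑ χ ∈ s, c χ * ((Nat.card G : ℂ)⁻¹ * ∑ g : G, χ.1 g * ψ.1 g⁻¹)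
          = ∑ χ ∈ s, ∑ g : G, (Nat.card G : ℂ)⁻¹ * ψ.1 g⁻¹ * (c χ * χ.1 g) := by
            refine Finset.sum_congr rfl fun χ _ => ?_
            rw [Finset.mul_sum, Finset.mul_sum]
            exact Finset.sum_congr rfl fun g _ => by ring
        _ = ∑ g : G, (Nat.card G : ℂ)⁻¹ * ψ.1 g⁻¹ * ∑ χ ∈ s, c χ * χ.1 g := by
            rw [Finset.sum_comm]
            exact Finset.sum_congr rfl fun g _ => by rw [Finset.mul_sum]
        _ = 0 := by simp [h3]
    simp only [key, mul_ite, mul_one, mul_zero, Finset.sum_ite_eq', if_pos hψ] at h2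
    exact h2
  exact li.finite

/-- The trivial character `1_G`, as an element of `Irr(G)`. -/
def trivIrr (G : Type*) [Group G] : Irr G :=
  ⟨fun _ => 1, 1, Representation.trivial ℂ G (Fin 1 → ℂ), by
    constructor
    · refine @IsSimpleOrder.mk _ _ _ ?_ ?_
      · refine ⟨⊥, ⊤, fun h => ?_⟩
        have h1 : (fun _ => 1 : Fin 1 → ℂ) ∈
            (⊥ : Subrepresentation (Representation.trivial ℂ G (Fin 1 → ℂ))) := by
          rw [h]; trivial
        have h2 : (fun _ => 1 : Fin 1 → ℂ) = 0 := h1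
        simpa using congrFun h2 0
      · intro a
        have : IsSimpleModule ℂ (Fin 1 → ℂ) :=
          isSimpleModule_iff_finrank_eq_one.mpr (by simp)
        rcases eq_bot_or_eq_top a.toSubmodule with h | h
        · left
          exact Subrepresentation.toSubmodule_injective h
        · right
          exact Subrepresentation.toSubmodule_injective h
    · ext g
      simp [Representation.character]⟩

/-- The class function `∑ a_χ χ` with coefficients `a : Irr(G) → ℕ`. -/
noncomputable def charOf (G : Type*) [Group G] : (Irr G →₀ ℕ) →+ (G → ℂ) where
  toFun a := a.sum fun χ n => n • (χ : G → ℂ)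
  map_zero' := Finsupp.sum_zero_index
  map_add' _ _ := Finsupp.sum_add_index' (fun _ => zero_smul _ _) (fun _ _ _ => add_smul _ _ _)

/-- `Ch(G)`: the monoid of all characters of `G` together with `0`. -/
noncomputable def chMonoid (G : Type*) [Group G] : AddSubmonoid (G → ℂ) :=
  AddMonoidHom.mrange (charOf G)

/-- `Mon(G)`: the monomial characters, i.e. those induced from linear characters of subgroups. -/
def monomialChars (G : Type*) [Group G] [Fintype G] : Set (G → ℂ) :=
  {χ | ∃ (H : Subgroup G) (lam : H →* ℂˣ), inducedLinear H lam = χ}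

/-- `M(G)`: the monoid generated by the monomial characters. -/
def monomialMonoid (G : Type*) [Group G] [Fintype G] : AddSubmonoid (G → ℂ) :=
  AddSubmonoid.closure (monomialChars G)

/-- The integral closure in `N` of a submonoid `M`: all `a ∈ N` with `n a ∈ M` for some `n ≥ 1`. -/
def monoidIntegralClosure {A : Type*} [AddCommMonoid A] (M N : AddSubmonoid A) :
    AddSubmonoid A where
  carrier := {a | a ∈ N ∧ ∃ n : ℕ, 0 < n ∧ n • a ∈ M}
  zero_mem' := ⟨N.zero_mem, 1, one_pos, by rw [smul_zero]; exact M.zero_mem⟩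
  add_mem' := by
    rintro a b ⟨ha, n, hn, hna⟩ ⟨hb, m, hm, hmb⟩
    refine ⟨N.add_mem ha hb, n * m, Nat.mul_pos hn hm, ?_⟩
    rw [smul_add, mul_comm, mul_smul, mul_comm, mul_smul]
    exact M.add_mem (M.nsmul_mem hna m) (M.nsmul_mem hmb n)

/-- `K[N]` for a monoid `N` of characters: the subalgebra of `K[x_χ : χ ∈ Irr(G)]` generated by
the monomials `∏ x_χ ^ a_χ` with `∑ a_χ χ ∈ N`. -/
noncomputable def monoidSubalgebra (K : Type*) [Field K] {G : Type*} [Group G]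
    (N : AddSubmonoid (G → ℂ)) : Subalgebra K (MvPolynomial (Irr G) K) :=
  Algebra.adjoin K {u | ∃ a : Irr G →₀ ℕ, charOf G a ∈ N ∧ u = MvPolynomial.monomial a 1}

/-- The algebra `R_G = K[M(G)]`. -/
noncomputable def algRG (K : Type*) [Field K] (G : Type*) [Group G] [Fintype G] :
    Subalgebra K (MvPolynomial (Irr G) K) :=
  monoidSubalgebra K (monomialMonoid G)

/-- The normalization of `R_G`: the algebra `K[M]`, `M` the integral closure of `M(G)` in
`Ch(G)`. -/
noncomputable def algRGhat (K : Type*) [Field K] (G : Type*) [Group G] [Fintype G] :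
    Subalgebra K (MvPolynomial (Irr G) K) :=
  monoidSubalgebra K (monoidIntegralClosure (monomialMonoid G) (chMonoid G))

/-- The exponent vector `(d_χ)` of `u_G = ∏ x_χ ^ d_χ`. -/
noncomputable def regExponent (G : Type*) [Group G] [Finite G] : Irr G →₀ ℕ :=
  Finsupp.equivFunOnFinite.symm irrDegree

/-- The monomial `u_G / x_j`. The subtraction of exponents does not truncate: see
`X_mul_regQuotient`. -/
noncomputable def regQuotient (K : Type*) [Field K] (G : Type*) [Group G] [Finite G] (j : Irr G) :
    MvPolynomial (Irr G) K :=
  MvPolynomial.monomial (regExponent G - Finsupp.single j 1) 1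

theorem X_mul_regQuotient (K : Type*) [Field K] (G : Type*) [Group G] [Finite G] (j : Irr G) :
    MvPolynomial.X j * regQuotient K G j = MvPolynomial.monomial (regExponent G) 1 := by
  have h : Finsupp.single j 1 ≤ regExponent G := by
    rw [Finsupp.single_le_iff]
    exact irrDegree_pos j
  rw [regQuotient, MvPolynomial.X, MvPolynomial.monomial_mul, one_mul, add_tsub_cancel_of_le h]

/-!
For each irreducible character `χ` of `G`, the multiple `|G| (ρ - χ)` of the regular character `ρ`
minus `χ` is a sum of monomial characters (`card_nsmul_regularChar_sub_mem`); since
`ρ = ∑ d_χ χ` (`charOf_regExponent`), this puts the exponent vector of `u_G / x_χ` into the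
integral closure. The trivial character is itself monomial.

For a cyclic subgroup `C` let `θ_C` be the function on `C` equal to `|C|` on the generators of `C`
and to `0` elsewhere. Every element of `G` generates exactly one cyclic subgroup, hence
`|G| χ = ∑_C Ind_C (θ_C χ)` (`sum_induceFun_generatorPart`). The multiplicity of a linear character
`λ` of `C` in `θ_C χ` is `s_λ = ∑ χ(x) λ(x⁻¹)`, over the generators `x` of `C`. It is an integer, by
induction over the subgroups of `C` (`sum_generators_mem`), and it is at most the sum of `|χ(x)|`
over the generators of `C`, hence at most the integral part `n_C` of this sum. So
`n_C ρ_C - θ_C χ`, with `ρ_C` the regular character of `C`, is a sum of linear characters of `C`, and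
it induces to `n_C ρ - Ind_C (θ_C χ) ∈ M(G)` (`induceFun_sub_generatorPart_mem`).

Finally `∑_C n_C ≤ ∑_{x ∈ G} |χ(x)| ≤ |G|` by Cauchy–Schwarz and `⟨χ, χ⟩ = 1`
(`sum_norm_irr_le`), so `|G| (ρ - χ)` differs from the sum of these elements of `M(G)` by a
nonnegative multiple of `ρ`, which is induced from the trivial subgroup.
-/

/-! ### Characters of finite-dimensional representations -/

/-- An isomorphism of representations identifies the subrepresentations, hence preserves
irreducibility. -/
theorem Representation.Equiv.isIrreducible {k G V W : Type*} [Field k] [Group G]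
    [AddCommGroup V] [Module k V] [AddCommGroup W] [Module k W]
    {ρ : Representation k G V} {σ : Representation k G W} (e : ρ.Equiv σ)
    (h : ρ.IsIrreducible) : σ.IsIrreducible := by
  have hcomm : ∀ g v, e.toLinearEquiv (ρ g v) = σ g (e.toLinearEquiv v) := fun g v =>
    congrArg (fun f : V →ₗ[k] W => f v) (e.isIntertwining' g)
  let f : Subrepresentation σ ≃o Subrepresentation ρ :=
    { toFun := fun b => ⟨b.toSubmodule.comap e.toLinearEquiv.toLinearMap, fun g v hv => by
        change e.toLinearEquiv (ρ g v) ∈ b.toSubmodule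
        rw [hcomm]
        exact b.apply_mem_toSubmodule g hv⟩
      invFun := fun a => ⟨a.toSubmodule.map e.toLinearEquiv.toLinearMap, by
        rintro g _ ⟨v, hv, rfl⟩
        exact ⟨ρ g v, a.apply_mem_toSubmodule g hv, hcomm g v⟩⟩
      left_inv := fun b => Subrepresentation.toSubmodule_injective
        (Submodule.map_comap_eq_of_surjective e.toLinearEquiv.surjective _)
      right_inv := fun a => Subrepresentation.toSubmodule_injective
        (Submodule.comap_map_eq_of_injective e.toLinearEquiv.injective _)
      map_rel_iff' := by
        intro a b
        exact Submodule.comap_le_comap_iff_of_surjective e.toLinearEquiv.surjective }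
  exact f.isSimpleOrder_iff.mpr h

theorem Representation.exists_equiv_fin {k G V : Type*} [Field k] [Group G]
    [AddCommGroup V] [Module k V] [FiniteDimensional k V] (ρ : Representation k G V) :
    ∃ σ : Representation k G (Fin (Module.finrank k V) → k), Nonempty (ρ.Equiv σ) := by
  let e : V ≃ₗ[k] (Fin (Module.finrank k V) → k) := (Module.finBasis k V).equivFun
  refine ⟨(e.conjAlgEquiv k : _ →* _).comp ρ, ⟨Representation.Equiv.mk e fun g => ?_⟩⟩
  ext v : 1
  simp

theorem Representation.character_eq_add_of_isCompl {k G V : Type*} [Field k] [Group G]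
    [AddCommGroup V] [Module k V] [FiniteDimensional k V] {ρ : Representation k G V}
    {σ τ : Subrepresentation ρ} (h : IsCompl σ.toSubmodule τ.toSubmodule) :
    ρ.character = σ.toRepresentation.character + τ.toRepresentation.character := by
  funext g
  let e := Submodule.prodEquivOfIsCompl _ _ h
  have key : ρ g = e.conj ((σ.toRepresentation g).prodMap (τ.toRepresentation g)) := by
    ext v
    obtain ⟨⟨x, y⟩, rfl⟩ := e.surjective v
    rw [LinearEquiv.conj_apply_apply, e.symm_apply_apply]
    simp [e, Subrepresentation.toRepresentation]
  simp only [Representation.character, Pi.add_apply]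
  rw [key, LinearMap.trace_conj', LinearMap.trace_prodMap']

theorem Representation.IsIrreducible.character_mem_irrChars {G V : Type*} [Group G]
    [AddCommGroup V] [Module ℂ V] [FiniteDimensional ℂ V] {ρ : Representation ℂ G V}
    (h : ρ.IsIrreducible) : ρ.character ∈ irrChars G := by
  obtain ⟨σ, ⟨e⟩⟩ := ρ.exists_equiv_fin
  exact ⟨_, σ, e.isIrreducible h, (Representation.char_iso e).symm⟩

theorem mem_chMonoid_of_mem_irrChars {G : Type*} [Group G] {χ : G → ℂ} (h : χ ∈ irrChars G) :
    χ ∈ chMonoid G :=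
  ⟨Finsupp.single ⟨χ, h⟩ 1, by simp [charOf]⟩

/-- Every character of a finite group is a sum of irreducible characters, by Maschke's theorem
and induction on the dimension. -/
theorem Representation.character_mem_chMonoid {G V : Type*} [Group G] [Finite G]
    [AddCommGroup V] [Module ℂ V] [FiniteDimensional ℂ V] (ρ : Representation ℂ G V) :
    ρ.character ∈ chMonoid G := by
  induction hn : Module.finrank ℂ V using Nat.strong_induction_on generalizing V with
  | _ n ih =>
  subst hn
  rcases subsingleton_or_nontrivial V with hV | hV
  · have h0 : ρ.character = 0 := by
      funext g
      have : ρ g = 0 := Subsingleton.elim _ _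
      simp [Representation.character, this]
    rw [h0]
    exact zero_mem _
  by_cases hirr : ρ.IsIrreducible
  · exact mem_chMonoid_of_mem_irrChars hirr.character_mem_irrChars
  have : Nontrivial (Subrepresentation ρ) := by
    refine ⟨⊥, ⊤, fun h => ?_⟩
    have h' : (⊥ : Submodule ℂ V) = ⊤ := congrArg Subrepresentation.toSubmodule h
    exact bot_ne_top h'
  obtain ⟨σ, hσ0, hσ1⟩ : ∃ σ : Subrepresentation ρ, σ ≠ ⊥ ∧ σ ≠ ⊤ := by
    by_contra! hcon
    exact hirr ⟨fun a => or_iff_not_imp_left.mpr (hcon a)⟩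
  have : NeZero (Nat.card G : ℂ) := ⟨by exact_mod_cast Nat.card_pos.ne'⟩
  obtain ⟨τ, hτ⟩ := exists_isCompl σ
  have hc : IsCompl σ.toSubmodule τ.toSubmodule := by
    constructor
    · rw [disjoint_iff]
      exact congrArg Subrepresentation.toSubmodule hτ.inf_eq_bot
    · rw [codisjoint_iff]
      exact congrArg Subrepresentation.toSubmodule hτ.sup_eq_top
  have hτ1 : τ ≠ ⊤ := by
    rintro rfl
    exact hσ0 (by simpa using hτ.inf_eq_bot)
  have hlt : ∀ a : Subrepresentation ρ, a ≠ ⊤ →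
      Module.finrank ℂ a.toSubmodule < Module.finrank ℂ V := fun a ha =>
    Submodule.finrank_lt fun h => ha (Subrepresentation.toSubmodule_injective h)
  rw [Representation.character_eq_add_of_isCompl hc]
  exact add_mem (ih _ (hlt σ hσ1) σ.toRepresentation rfl)
    (ih _ (hlt τ hτ1) τ.toRepresentation rfl)

/-! ### The regular character -/

/-- The right regular representation, on the functions `G → k`. -/
def rightRegular (k G : Type*) [Field k] [Group G] : Representation k G (G → k) where
  toFun g := LinearMap.funLeft k k (· * g)
  map_one' := by ext; simp [LinearMap.funLeft]
  map_mul' g h := by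
    ext f x
    simp [LinearMap.funLeft, mul_assoc]

open scoped Classical in
/-- The class function with value `|G|` at `1` and `0` elsewhere. -/
noncomputable def regularChar (G : Type*) [Group G] : G → ℂ :=
  fun g => if g = 1 then (Nat.card G : ℂ) else 0

theorem character_rightRegular (G : Type*) [Group G] [Finite G] :
    (rightRegular ℂ G).character = regularChar G := by
  classical
  have := Fintype.ofFinite G
  funext g
  rw [Representation.character, LinearMap.trace_eq_matrix_trace ℂ (Pi.basisFun ℂ G),
    Matrix.trace]
  have h : ∀ x : G, (LinearMap.toMatrix (Pi.basisFun ℂ G) (Pi.basisFun ℂ G)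
      (rightRegular ℂ G g)).diag x = if g = 1 then 1 else 0 := by
    intro x
    simp [rightRegular, LinearMap.funLeft, Pi.single_apply]
  simp only [h, regularChar]
  simp

open scoped Classical in
theorem irrChars_orthonormal {G : Type*} [Group G] [Fintype G] (χ ψ : Irr G) :
    (Nat.card G : ℂ)⁻¹ * ∑ g : G, χ.1 g * ψ.1 g⁻¹ = if χ = ψ then 1 else 0 := by
  have := invertibleOfNonzero
    (show (Nat.card G : ℂ) ≠ 0 by exact_mod_cast Nat.card_pos.ne')
  obtain ⟨χ, n, ρ, hρ, rfl⟩ := χ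
  obtain ⟨ψ, m, σ, hσ, rfl⟩ := ψ
  rw [Representation.char_orthonormal ρ σ]
  refine if_congr ⟨?_, fun h => ?_⟩ rfl rfl
  · rintro ⟨e⟩
    exact Subtype.ext (Representation.char_iso e).symm
  · -- Otherwise the inner product of `ρ.character` with itself would vanish.
    by_contra hne
    have h1 := Representation.char_orthonormal ρ σ
    rw [if_neg hne, ← show ρ.character = σ.character from congrArg Subtype.val h,
      Representation.char_orthonormal ρ ρ, if_pos ⟨Representation.Equiv.refl ρ⟩] at h1
    exact one_ne_zero h1

theorem charOf_apply {G : Type*} [Group G] [Fintype (Irr G)] (a : Irr G →₀ ℕ) (g : G) :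
    charOf G a g = ∑ χ : Irr G, (a χ : ℂ) * χ.1 g := by
  simp [charOf, Finsupp.sum_fintype]

/-- The coefficients of a character are its inner products with the irreducible characters. -/
theorem inner_charOf {G : Type*} [Group G] [Fintype G] (a : Irr G →₀ ℕ) (ψ : Irr G) :
    (Nat.card G : ℂ)⁻¹ * ∑ g : G, charOf G a g * ψ.1 g⁻¹ = a ψ := by
  classical
  have := Fintype.ofFinite (Irr G)
  calc (Nat.card G : ℂ)⁻¹ * ∑ g : G, charOf G a g * ψ.1 g⁻¹
      = ∑ χ : Irr G, (a χ : ℂ) * ((Nat.card G : ℂ)⁻¹ * ∑ g : G, χ.1 g * ψ.1 g⁻¹) := by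
        simp only [charOf_apply, Finset.sum_mul, Finset.mul_sum]
        rw [Finset.sum_comm]
        exact Finset.sum_congr rfl fun _ _ => Finset.sum_congr rfl fun _ _ => by ring
    _ = a ψ := by simp only [irrChars_orthonormal]; simp

/-- The decomposition `∑ d_χ χ` of the regular character. -/
theorem charOf_regExponent (G : Type*) [Group G] [Finite G] :
    charOf G (regExponent G) = regularChar G := by
  classical
  have := Fintype.ofFinite G
  obtain ⟨a, ha⟩ : regularChar G ∈ chMonoid G :=
    character_rightRegular G ▸ (rightRegular ℂ G).character_mem_chMonoid
  suffices h : regExponent G = a by rw [h, ha]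
  ext χ
  have h1 := inner_charOf a χ
  rw [ha] at h1
  have hc : (Nat.card G : ℂ) ≠ 0 := by exact_mod_cast Nat.card_pos.ne'
  simp only [regularChar, ite_mul, zero_mul, Finset.sum_ite_eq', Finset.mem_univ, if_true,
    inv_one, irrDegree_spec, inv_mul_cancel_left₀ hc] at h1
  exact_mod_cast h1

/-! ### Linear characters of finite abelian groups -/

theorem norm_linearChar {A : Type*} [Group A] [Finite A] (lam : A →* ℂˣ) (a : A) :
    ‖((lam a : ℂˣ) : ℂ)‖ = 1 := by
  refine Complex.norm_eq_one_of_pow_eq_one (n := Nat.card A) ?_ Nat.card_pos.ne'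
  rw [← Units.val_pow_eq_pow_val, ← map_pow, pow_card_eq_one', map_one, Units.val_one]

theorem star_linearChar {A : Type*} [Group A] [Finite A] (lam : A →* ℂˣ) (a : A) :
    star ((lam a : ℂˣ) : ℂ) = ((lam a⁻¹ : ℂˣ) : ℂ) := by
  rw [map_inv, Units.val_inv_eq_inv_val, Complex.inv_def, Complex.normSq_eq_norm_sq,
    norm_linearChar]
  simp

open scoped Classical in
theorem sum_linearChar {A : Type*} [CommGroup A] [Finite A] [Fintype (A →* ℂˣ)] (a : A) :
    ∑ lam : A →* ℂˣ, ((lam a : ℂˣ) : ℂ) = if a = 1 then (Nat.card A : ℂ) else 0 := by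
  split_ifs with h
  · subst h
    simp [← CommGroup.card_monoidHom_of_hasEnoughRootsOfUnity A ℂ, Nat.card_eq_fintype_card]
  · obtain ⟨μ, hμ⟩ := CommGroup.exists_apply_ne_one_of_hasEnoughRootsOfUnity A ℂ h
    have h1 : ((μ a : ℂˣ) : ℂ) * ∑ lam : A →* ℂˣ, ((lam a : ℂˣ) : ℂ) =
        ∑ lam : A →* ℂˣ, ((lam a : ℂˣ) : ℂ) := by
      rw [Finset.mul_sum]
      exact Fintype.sum_equiv (Equiv.mulLeft μ) _ _ fun lam => by simp
    have h2 : ((μ a : ℂˣ) : ℂ) ≠ 1 := fun h' => hμ (Units.ext h')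
    by_contra h0
    exact h2 ((mul_eq_right₀ h0).1 h1)

/-- Fourier inversion on a finite abelian group. -/
theorem sum_fourier_linearChar {A : Type*} [CommGroup A] [Fintype A] [Fintype (A →* ℂˣ)]
    (f : A → ℂ) (a : A) :
    ∑ lam : A →* ℂˣ, (∑ x : A, f x * ((lam x⁻¹ : ℂˣ) : ℂ)) * ((lam a : ℂˣ) : ℂ) =
      Nat.card A * f a := by
  classical
  calc ∑ lam : A →* ℂˣ, (∑ x : A, f x * ((lam x⁻¹ : ℂˣ) : ℂ)) * ((lam a : ℂˣ) : ℂ)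
      = ∑ x : A, f x * ∑ lam : A →* ℂˣ, ((lam (x⁻¹ * a) : ℂˣ) : ℂ) := by
        simp only [Finset.sum_mul, Finset.mul_sum]
        rw [Finset.sum_comm]
        simp [mul_assoc]
    _ = Nat.card A * f a := by
        simp only [sum_linearChar, inv_mul_eq_one, mul_ite, mul_zero, Finset.sum_ite_eq',
          Finset.mem_univ, if_true]
        ring

/-- The one-dimensional representation afforded by a linear character. -/
def linearRep {A : Type*} [Group A] (lam : A →* ℂˣ) : Representation ℂ A ℂ :=
  (Algebra.lmul ℂ ℂ : ℂ →* Module.End ℂ ℂ).comp ((Units.coeHom ℂ).comp lam)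

theorem character_linearRep {A : Type*} [Group A] (lam : A →* ℂˣ) (a : A) :
    (linearRep lam).character a = ((lam a : ℂˣ) : ℂ) := by
  have h : linearRep lam a = ((lam a : ℂˣ) : ℂ) • (1 : Module.End ℂ ℂ) := by
    ext; simp [linearRep]
  simp [Representation.character, h]

/-- The multiplicity of a linear character in a character is a natural number. -/
theorem exists_sum_character_mul_linearChar {A V : Type*} [Group A] [Fintype A]
    [AddCommGroup V] [Module ℂ V] [FiniteDimensional ℂ V] (ρ : Representation ℂ A V)
    (lam : A →* ℂˣ) :
    ∃ m : ℕ, ∑ x : A, ρ.character x * ((lam x⁻¹ : ℂˣ) : ℂ) = Nat.card A * m := by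
  have hc : (Nat.card A : ℂ) ≠ 0 := by exact_mod_cast Nat.card_pos.ne'
  have := invertibleOfNonzero hc
  have h := Representation.card_inv_mul_sum_char_mul_char_eq_finrank (linearRep lam) ρ
  simp only [character_linearRep] at h
  exact ⟨_, by rw [← h, mul_inv_cancel_left₀ hc]⟩

/-- The values of a character at inverse elements are conjugate. On the cyclic group generated
by the element, the character is a sum of linear characters by Fourier inversion. -/
theorem Representation.character_inv_eq_star {G V : Type*} [Group G] [Finite G]
    [AddCommGroup V] [Module ℂ V] [FiniteDimensional ℂ V] (ρ : Representation ℂ G V) (g : G) :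
    ρ.character g⁻¹ = star (ρ.character g) := by
  have := Fintype.ofFinite (Subgroup.zpowers g)
  let _ : CommGroup (Subgroup.zpowers g) := IsCyclic.commGroup
  have := Fintype.ofFinite (Subgroup.zpowers g →* ℂˣ)
  have hc : (Nat.card (Subgroup.zpowers g) : ℂ) ≠ 0 := by exact_mod_cast Nat.card_pos.ne'
  let σ : Representation ℂ (Subgroup.zpowers g) V := ρ.comp (Subgroup.zpowers g).subtype
  choose m hm using exists_sum_character_mul_linearChar σ
  have key : ∀ a : Subgroup.zpowers g,
      ρ.character a = ∑ lam : Subgroup.zpowers g →* ℂˣ, (m lam : ℂ) * ((lam a : ℂˣ) : ℂ) := by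
    intro a
    have h := sum_fourier_linearChar σ.character a
    simp only [hm, mul_assoc] at h
    rw [← Finset.mul_sum] at h
    exact (mul_left_cancel₀ hc h).symm
  let a : Subgroup.zpowers g := ⟨g, Subgroup.mem_zpowers g⟩
  have h1 := key a
  have h2 := key a⁻¹
  change ρ.character g = _ at h1
  change ρ.character g⁻¹ = _ at h2
  rw [h1, h2, star_sum]
  refine Finset.sum_congr rfl fun lam _ => ?_
  rw [star_mul', star_linearChar]
  simp

/-- By Cauchy–Schwarz and orthonormality, an irreducible character has mean absolute value at
most `1`. -/
theorem sum_norm_irr_le {G : Type*} [Group G] [Fintype G] (χ : Irr G) :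
    ∑ g : G, ‖χ.1 g‖ ≤ Nat.card G := by
  have hc : (Nat.card G : ℂ) ≠ 0 := by exact_mod_cast Nat.card_pos.ne'
  have h1 : ∑ g : G, ‖χ.1 g‖ ^ 2 = Nat.card G := by
    have h := irrChars_orthonormal χ χ
    rw [if_pos rfl, inv_mul_eq_one₀ hc] at h
    have h' : ∀ g, χ.1 g * χ.1 g⁻¹ = ((‖χ.1 g‖ ^ 2 : ℝ) : ℂ) := by
      obtain ⟨_, n, ρ, hρ, rfl⟩ := χ
      intro g
      change ρ.character g * ρ.character g⁻¹ = ((‖ρ.character g‖ ^ 2 : ℝ) : ℂ)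
      rw [ρ.character_inv_eq_star]
      simpa using Complex.mul_conj' (ρ.character g)
    simp only [h'] at h
    exact_mod_cast h.symm
  have h2 := sq_sum_le_card_mul_sum_sq (s := Finset.univ) (f := fun g : G => ‖χ.1 g‖)
  rw [h1, Finset.card_univ, ← Nat.card_eq_fintype_card, ← sq] at h2
  exact le_of_sq_le_sq h2 (Nat.cast_nonneg _)

/-! ### Sums over the generators of a cyclic group -/

open scoped Classical in
/-- A Möbius inversion on the lattice of subgroups: if the sum of `f` over every subgroup lies in
`T`, then so does the sum of `f` over the elements that generate a given subgroup. -/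
theorem sum_generators_mem {A B : Type*} [Group A] [Fintype A] [AddCommGroup B]
    (T : AddSubgroup B) (f : A → B) (h : ∀ E : Subgroup A, ∑ x with x ∈ E, f x ∈ T)
    (E : Subgroup A) : ∑ x with Subgroup.zpowers x = E, f x ∈ T := by
  induction hn : Nat.card E using Nat.strong_induction_on generalizing E with
  | _ n ih =>
  subst hn
  have := Fintype.ofFinite (Subgroup A)
  have h1 : ∑ x with x ∈ E, f x =
      ∑ D with D ≤ E, ∑ x with Subgroup.zpowers x = D, f x := by
    rw [← Finset.sum_fiberwise_of_maps_to (s := {x : A | x ∈ E})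
      (t := {D : Subgroup A | D ≤ E}) (g := Subgroup.zpowers)]
    · refine Finset.sum_congr rfl fun D hD => Finset.sum_congr ?_ fun _ _ => rfl
      ext x
      simp only [Finset.mem_filter, Finset.mem_univ, true_and] at hD ⊢
      exact ⟨fun hx => hx.2, fun hx => ⟨hD (hx ▸ Subgroup.mem_zpowers x), hx⟩⟩
    · intro x hx
      simpa using hx
  rw [← Finset.add_sum_erase _ _ (show E ∈ ({D | D ≤ E} : Finset (Subgroup A)) by simp)] at h1
  rw [eq_sub_of_add_eq h1.symm]
  refine sub_mem (h E) (sum_mem fun D hD => ih _ ?_ D rfl)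
  simp only [Finset.mem_erase, Finset.mem_filter, Finset.mem_univ, true_and] at hD
  exact lt_of_not_ge fun hle => hD.1 (Subgroup.eq_of_le_of_card_ge hD.2 hle)

open scoped Classical in
/-- Over the generators of `A` only, the sum of a character times an inverse linear character is
an integer, since over each subgroup the sum is a multiple of a multiplicity. -/
theorem exists_int_sum_generators {A V : Type*} [Group A] [Fintype A]
    [AddCommGroup V] [Module ℂ V] [FiniteDimensional ℂ V] (ρ : Representation ℂ A V)
    (lam : A →* ℂˣ) :
    ∃ s : ℤ, ∑ x : A, (if Subgroup.zpowers x = ⊤ then ρ.character x else 0) *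
      ((lam x⁻¹ : ℂˣ) : ℂ) = s := by
  have h := sum_generators_mem (Int.castAddHom ℂ).range
    (fun x => ρ.character x * ((lam x⁻¹ : ℂˣ) : ℂ)) (fun E => ?_) ⊤
  · obtain ⟨s, hs⟩ := h
    refine ⟨s, ?_⟩
    simp only [ite_mul, zero_mul]
    rw [← Finset.sum_filter]
    exact hs.symm
  · obtain ⟨m, hm⟩ := exists_sum_character_mul_linearChar
      (A := E) (ρ.comp E.subtype) (lam.comp E.subtype)
    refine ⟨Nat.card E * m, ?_⟩
    rw [Finset.sum_subtype _ (p := (· ∈ E)) (by simp)]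
    simpa [Representation.character] using hm.symm

/-! ### Induction of functions from subgroups -/

open scoped Classical in
/-- Induction of functions from `H` to `G`: `inducedLinear H lam` is the case of a linear
character. -/
noncomputable def induceFun {G : Type*} [Group G] [Fintype G] (H : Subgroup G) :
    (H → ℂ) →ₗ[ℂ] (G → ℂ) where
  toFun f g := (Nat.card H : ℂ)⁻¹ *
    ∑ x : G, if h : x⁻¹ * g * x ∈ H then f ⟨x⁻¹ * g * x, h⟩ else 0
  map_add' f f' := by
    funext g
    simp only [Pi.add_apply, ← mul_add, ← Finset.sum_add_distrib]
    congr! with x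
    split_ifs <;> simp
  map_smul' c f := by
    funext g
    simp only [Pi.smul_apply, smul_eq_mul, RingHom.id_apply]
    rw [mul_left_comm, Finset.mul_sum (a := c)]
    congr! with x
    split_ifs <;> simp

theorem induceFun_linearChar {G : Type*} [Group G] [Fintype G] (H : Subgroup G)
    (lam : H →* ℂˣ) : induceFun H (fun h => ((lam h : ℂˣ) : ℂ)) = inducedLinear H lam :=
  rfl

theorem induceFun_mem_monomialMonoid {G : Type*} [Group G] [Fintype G] (H : Subgroup G)
    [Fintype (H →* ℂˣ)] (n : (H →* ℂˣ) → ℕ) :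
    induceFun H (fun h => ∑ lam : H →* ℂˣ, (n lam : ℂ) * ((lam h : ℂˣ) : ℂ)) ∈
      monomialMonoid G := by
  have h : (fun h => ∑ lam : H →* ℂˣ, (n lam : ℂ) * ((lam h : ℂˣ) : ℂ)) =
      ∑ lam : H →* ℂˣ, n lam • fun h => ((lam h : ℂˣ) : ℂ) := by
    funext h
    simp
  rw [h, map_sum]
  refine sum_mem fun lam _ => ?_
  rw [map_nsmul, induceFun_linearChar]
  have hmem : inducedLinear H lam ∈ monomialChars G := ⟨H, lam, rfl⟩
  exact nsmul_mem (AddSubmonoid.subset_closure hmem) _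

theorem induceFun_regularChar {G : Type*} [Group G] [Fintype G] (H : Subgroup G) :
    induceFun H (regularChar H) = regularChar G := by
  classical
  funext g
  have hc : (Nat.card H : ℂ) ≠ 0 := by exact_mod_cast Nat.card_pos.ne'
  have h : ∀ x : G, (if h : x⁻¹ * g * x ∈ H then regularChar H ⟨x⁻¹ * g * x, h⟩ else 0) =
      if g = 1 then (Nat.card H : ℂ) else 0 := by
    intro x
    have hx : x⁻¹ * g * x = 1 ↔ g = 1 := by
      simpa using conj_eq_one_iff (a := x⁻¹) (b := g)
    by_cases hg : g = 1
    · subst hg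
      simp [regularChar]
    · simp [regularChar, hx, hg]
  simp only [induceFun, LinearMap.coe_mk, AddHom.coe_mk, h]
  simp only [regularChar]
  split_ifs
  · simp only [Finset.sum_const, Finset.card_univ, nsmul_eq_mul, ← Nat.card_eq_fintype_card]
    field_simp
  · simp

/-- The regular character is induced from the trivial subgroup. -/
theorem regularChar_mem_monomialMonoid (G : Type*) [Group G] [Fintype G] :
    regularChar G ∈ monomialMonoid G := by
  refine AddSubmonoid.subset_closure ⟨⊥, 1, ?_⟩
  rw [← induceFun_regularChar (⊥ : Subgroup G), ← induceFun_linearChar]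
  congr 1
  funext h
  simp [regularChar, Subsingleton.elim h 1]

open scoped Classical in
/-- The function on `C` equal to `|C| χ` on the generators of `C` and to `0` elsewhere. -/
noncomputable def generatorPart {G : Type*} [Group G] (χ : G → ℂ) (C : Subgroup G) : C → ℂ :=
  fun x => if Subgroup.zpowers x = ⊤ then (Nat.card C : ℂ) * χ x else 0

theorem Subgroup.zpowers_eq_top_iff_coe {G : Type*} [Group G] {C : Subgroup G} (x : C) :
    Subgroup.zpowers x = ⊤ ↔ Subgroup.zpowers (x : G) = C := by
  rw [← Subgroup.map_injective C.subtype_injective |>.eq_iff, ← MonoidHom.range_eq_map,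
    Subgroup.range_subtype, MonoidHom.map_zpowers]
  rfl

/-- Artin's identity: `|G| χ` is a sum of functions induced from the subgroups, in which only
the cyclic ones contribute. -/
theorem sum_induceFun_generatorPart {G : Type*} [Group G] [Fintype G] [Fintype (Subgroup G)]
    (χ : G → ℂ) (hχ : ∀ g x, χ (x⁻¹ * g * x) = χ g) :
    ∑ C : Subgroup G, induceFun C (generatorPart χ C) = (Nat.card G : ℂ) • χ := by
  classical
  have hC : ∀ (C : Subgroup G) (g : G), induceFun C (generatorPart χ C) g =
      ∑ x : G, if Subgroup.zpowers (x⁻¹ * g * x) = C then χ g else 0 := by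
    intro C g
    have hc : (Nat.card C : ℂ) ≠ 0 := by exact_mod_cast Nat.card_pos.ne'
    simp only [induceFun, LinearMap.coe_mk, AddHom.coe_mk, Finset.mul_sum]
    refine Finset.sum_congr rfl fun x _ => ?_
    by_cases hx : x⁻¹ * g * x ∈ C
    · simp only [hx, dif_pos, generatorPart, Subgroup.zpowers_eq_top_iff_coe, hχ]
      split_ifs
      · field_simp
      · simp
    · rw [dif_neg hx, if_neg, mul_zero]
      rintro rfl
      exact hx (Subgroup.mem_zpowers _)
  funext g
  simp only [Finset.sum_apply, hC]
  rw [Finset.sum_comm]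
  simp

/-! ### The regular character minus an irreducible character -/

open scoped Classical in
/-- Let `n` be the integral part of the sum of `|χ|` over the generators of `C`. In `n` times the
regular character of `C` minus `generatorPart χ C`, the multiplicity of a linear character is an
integer `n - s`, and `s ≤ n` by the triangle inequality. Inducing from `C` to `G` gives the
claim. -/
theorem induceFun_sub_generatorPart_mem {G V : Type*} [Group G] [Fintype G]
    [AddCommGroup V] [Module ℂ V] [FiniteDimensional ℂ V] (ρ : Representation ℂ G V)
    (C : Subgroup G) :
    ⌊∑ x with Subgroup.zpowers x = C, ‖ρ.character x‖⌋₊ • regularChar G -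
      induceFun C (generatorPart ρ.character C) ∈ monomialMonoid G := by
  set n : ℕ := ⌊∑ x with Subgroup.zpowers x = C, ‖ρ.character x‖⌋₊ with hn
  by_cases hcyc : ∃ x, Subgroup.zpowers x = C
  swap
  · -- A subgroup that is not cyclic has no generators.
    have h0 : generatorPart ρ.character C = 0 := by
      funext x
      simp only [generatorPart, Subgroup.zpowers_eq_top_iff_coe]
      exact if_neg fun h => hcyc ⟨x, h⟩
    rw [h0, map_zero, sub_zero]
    exact nsmul_mem (regularChar_mem_monomialMonoid G) n
  have : IsCyclic C := by
    obtain ⟨x, rfl⟩ := hcyc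
    infer_instance
  let _ : CommGroup C := IsCyclic.commGroup
  have := Fintype.ofFinite (C →* ℂˣ)
  let σ : Representation ℂ C V := ρ.comp C.subtype
  let f : C → ℂ := fun x => if Subgroup.zpowers x = ⊤ then σ.character x else 0
  -- `s lam` is the multiplicity of `lam` in `generatorPart ρ.character C`.
  choose s hs using exists_int_sum_generators σ
  have hs' : ∀ lam : C →* ℂˣ, s lam ≤ n := by
    intro lam
    have h1 : (s lam : ℝ) ≤ ∑ x with Subgroup.zpowers x = C, ‖ρ.character x‖ :=
      calc (s lam : ℝ) ≤ ‖(s lam : ℂ)‖ := by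
            rw [Complex.norm_intCast]; exact le_abs_self _
        _ ≤ ∑ x : C, ‖f x * ((lam x⁻¹ : ℂˣ) : ℂ)‖ := by
            rw [← hs lam]; exact norm_sum_le _ _
        _ = ∑ x : C, if Subgroup.zpowers (x : G) = C then ‖ρ.character x‖ else 0 := by
            refine Finset.sum_congr rfl fun x _ => ?_
            rw [norm_mul, norm_linearChar, mul_one]
            simp only [f, Subgroup.zpowers_eq_top_iff_coe]
            split_ifs
            · rfl
            · simp
        _ = ∑ x with x ∈ C, if Subgroup.zpowers x = C then ‖ρ.character x‖ else 0 :=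
            (Finset.sum_subtype {x | x ∈ C} (p := (· ∈ C)) (by simp)
              fun x => if Subgroup.zpowers x = C then ‖ρ.character x‖ else 0).symm
        _ ≤ ∑ x, if Subgroup.zpowers x = C then ‖ρ.character x‖ else 0 :=
            Finset.sum_le_sum_of_subset_of_nonneg (Finset.subset_univ _) fun x _ _ => by
              split_ifs <;> simp
        _ = _ := (Finset.sum_filter _ _).symm
    -- The integer `s lam` is at most the real sum, hence at most its integral part.
    rw [hn, ← Int.floor_toNat]
    exact (Int.le_floor.mpr h1).trans (Int.self_le_toNat _)
  have h2 : n • regularChar C - generatorPart ρ.character C =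
      fun x => ∑ lam : C →* ℂˣ, ((n - s lam).toNat : ℂ) * ((lam x : ℂˣ) : ℂ) := by
    funext x
    have h3 : ∀ lam, ((n - s lam).toNat : ℂ) = n - s lam := fun lam => by
      have := Int.toNat_of_nonneg (sub_nonneg.mpr (hs' lam))
      exact_mod_cast congrArg (Int.cast : ℤ → ℂ) this
    have h4 := sum_fourier_linearChar f x
    simp only [f, hs] at h4
    simp only [h3, sub_mul, Finset.sum_sub_distrib, h4, ← Finset.mul_sum, sum_linearChar]
    simp [regularChar, generatorPart, σ, Representation.character]
  rw [← induceFun_regularChar C, ← map_nsmul, ← map_sub, h2]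
  exact induceFun_mem_monomialMonoid C _

/-- By Artin's identity, `|G| (regularChar G - χ)` is the sum over `C` of the functions of
`induceFun_sub_generatorPart_mem`, plus `|G| - ∑ n C` copies of the regular character, where `n C`
is the integral part of the sum of `|χ|` over the generators of `C`. This number of copies is
nonnegative by `sum_norm_irr_le`. -/
theorem card_nsmul_regularChar_sub_mem {G : Type*} [Group G] [Fintype G] (χ : Irr G) :
    Nat.card G • (regularChar G - χ.1) ∈ monomialMonoid G := by
  classical
  have := Fintype.ofFinite (Subgroup G)
  let n : Subgroup G → ℕ := fun C => ⌊∑ x with Subgroup.zpowers x = C, ‖χ.1 x‖⌋₊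
  have hn : ∑ C, n C ≤ Nat.card G := by
    have h : ∑ C, (n C : ℝ) ≤ Nat.card G :=
      calc ∑ C, (n C : ℝ) ≤ ∑ C, ∑ x with Subgroup.zpowers x = C, ‖χ.1 x‖ :=
            Finset.sum_le_sum fun C _ =>
              Nat.floor_le (Finset.sum_nonneg fun _ _ => norm_nonneg _)
        _ = ∑ x, ‖χ.1 x‖ := Finset.sum_fiberwise _ _ _
        _ ≤ Nat.card G := sum_norm_irr_le χ
    exact_mod_cast h
  have hmem : ∀ C, n C • regularChar G - induceFun C (generatorPart χ.1 C) ∈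
      monomialMonoid G := by
    obtain ⟨_, k, ρ, hρ, rfl⟩ := χ
    exact fun C => induceFun_sub_generatorPart_mem ρ C
  have hconj : ∀ g x, χ.1 (x⁻¹ * g * x) = χ.1 g := by
    obtain ⟨_, k, ρ, hρ, rfl⟩ := χ
    intro g x
    simpa using ρ.char_conj g x⁻¹
  have key : Nat.card G • (regularChar G - χ.1) =
      (Nat.card G - ∑ C, n C) • regularChar G +
        ∑ C, (n C • regularChar G - induceFun C (generatorPart χ.1 C)) := by
    rw [Finset.sum_sub_distrib, sum_induceFun_generatorPart χ.1 hconj, ← Finset.sum_smul,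
      ← add_sub_assoc, ← add_nsmul, Nat.sub_add_cancel hn, nsmul_sub, Nat.cast_smul_eq_nsmul]
  rw [key]
  exact add_mem (nsmul_mem (regularChar_mem_monomialMonoid G) _) (sum_mem fun C _ => hmem C)

theorem charOf_regExponent_sub {G : Type*} [Group G] [Finite G] (j : Irr G) :
    charOf G (regExponent G - Finsupp.single j 1) = regularChar G - j.1 := by
  have h : Finsupp.single j 1 ≤ regExponent G := by
    rw [Finsupp.single_le_iff]
    exact irrDegree_pos j
  have h1 : charOf G (Finsupp.single j 1) = j.1 := by simp [charOf]
  rw [eq_sub_iff_add_eq, ← charOf_regExponent, ← h1, ← map_add, tsub_add_cancel_of_le h]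

/-- The trivial character is induced from the whole group. -/
theorem one_mem_monomialMonoid (G : Type*) [Group G] [Fintype G] :
    (fun _ => 1 : G → ℂ) ∈ monomialMonoid G := by
  refine AddSubmonoid.subset_closure ⟨⊤, 1, ?_⟩
  funext g
  simp [inducedLinear]

theorem mainTheorem6 (K : Type*) [Field K] (G : Type*) [Group G] [Fintype G] :
    Algebra.adjoin K
        ({MvPolynomial.X (trivIrr G)} ∪ Set.range fun j : Irr G => regQuotient K G j) ≤
      algRGhat K G := by
  refine Algebra.adjoin_mono (Set.union_subset ?_ ?_)
  · rintro _ rfl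
    refine ⟨Finsupp.single (trivIrr G) 1, ⟨⟨_, rfl⟩, 1, one_pos, ?_⟩, rfl⟩
    rw [one_nsmul]
    simpa [charOf, trivIrr] using one_mem_monomialMonoid G
  · rintro _ ⟨j, rfl⟩
    refine ⟨_, ⟨⟨_, rfl⟩, Nat.card G, Nat.card_pos, ?_⟩, rfl⟩
    rw [charOf_regExponent_sub]
    exact card_nsmul_regularChar_sub_mem j
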